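/- Let $(D,\mu)$ be a measure space, and let $H$ be a reproducing kernel Hilbert space of complex-valued functions on $D$ (that is, a Hilbert space of functions $D\to\mathbb C$ on which every point evaluation $f\mapsto f(x)$, $x\in D$, is continuous) with reproducing kernel $K$. Write $\|\cdot\|_2$ for the norm of $L_2(D,\mu)$. Assume that every $f\in H$ is square-integrable with respect to $\mu$ and that $$\sup_{0\ne f\in H}\frac{\|f\|_2^2}{\|f\|_H^2}<\infty,\qquad \|f\|_2\neq 0\ \text{ for all } f\in H\setminus\{0\},\qquad \operatorname{Tr}(K):=\int_D K(x,x)\,d\mu(x)<\infty .$$ Let $V_m\subset H$ be a linear subspace of dimension $m\ge 1$ and let $n\ge m$ be an integer. Let $P_m$ be the $H$-orthogonal projection onto $V_m$, let $H_m$ be the $H$-orthogonal complement of $V_m$ with the norm of $H$, let $K_m$ be the reproducing kernel of $(H_m,\|\cdot\|_H)$, let $\operatorname{Tr}(K_m):=\int_D K_m(x,x)\,d\mu(x)$, and put $$\lambda_m:=\sup_{0\neq f\in H_m}\frac{\|f\|_2^2}{\|f\|_H^2},\qquad r:=\sqrt{\frac{m-1}{n}},\qquad s:=\sqrt{\frac{\operatorname{Tr}(K_m)-\lambda_m}{n\,\lambda_m}}$$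 (if $V_m=H$, put $\lambda_m:=0$ and $s:=0$). Then there are points $x_1,\dots,x_n\in D$ and weights $w_1,\dots,w_n>0$ such that for all data $y\in\mathbb C^n$ the weighted least squares problem $$\min_{g\in V_m}\ \sum_{i=1}^n w_i\,|y_i-g(x_i)|^2$$ has exactly one minimizer, and such that for every $f\in H$ the minimizer $\tilde f$ for the data $y_i=f(x_i)$ satisfies $$\|f-\tilde f\|_2\ \le\ \Bigl(1+\frac{1+s}{1-r}\Bigr)\sqrt{\lambda_m}\,\|f-P_mf\|_H .$$ -/

import Mathlib

open MeasureTheory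
open scoped ENNReal

namespace RKHSRecovery

/-- A linear subspace `W` of a reproducing kernel Hilbert space of complex-valued functions on `D`,
with the inherited norm, is again a Hilbert space of functions on `D` with continuous point
evaluations (complete as soon as `W` is closed). Its elements are the same functions. -/
noncomputable instance subspaceRKHS {D H : Type*} [NormedAddCommGroup H] [InnerProductSpace ℂ H]
    [RKHS ℂ H D ℂ] (W : Submodule ℂ H) : RKHS ℂ W D ℂ where
  coeCLM := (RKHS.coeCLM ℂ).comp W.subtypeL
  coeCLM_injective := fun _ _ h => Subtype.ext (RKHS.coeCLM_injective h)

@[simp]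
theorem subspaceRKHS_coe {D H : Type*} [NormedAddCommGroup H] [InnerProductSpace ℂ H]
    [RKHS ℂ H D ℂ] (W : Submodule ℂ H) (f : W) : (⇑f : D → ℂ) = ⇑(f : H) := rfl

/-- The scalar reproducing kernel `K : D × D → ℂ` of `H`. Mathlib's kernel takes values in the
linear operators on `ℂ`; each such operator is multiplication by its value at `1`. -/
noncomputable def scalarKernel {D : Type*} (H : Type*) [NormedAddCommGroup H]
    [InnerProductSpace ℂ H] [CompleteSpace H] [RKHS ℂ H D ℂ] (x y : D) : ℂ :=
  RKHS.kernel H x y 1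

/-- The diagonal `K(x,x) = ‖K(·,x)‖²` of the kernel is real and nonnegative. -/
theorem scalarKernel_self {D : Type*} (H : Type*) [NormedAddCommGroup H]
    [InnerProductSpace ℂ H] [CompleteSpace H] [RKHS ℂ H D ℂ] (x : D) :
    scalarKernel H x x = ((‖RKHS.kerFun H x 1‖ ^ 2 : ℝ) : ℂ) := by
  have h := RKHS.kernel_inner H x x 1 1
  rw [inner_self_eq_norm_sq_to_K] at h
  have h2 := congrArg (starRingEnd ℂ) h
  simpa [scalarKernel] using h2

/-- The trace `Tr(K) = ∫ K(x,x) dμ(x)` of the kernel of `H`, as an element of `[0,∞]`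
(the integrand is real and nonnegative by `scalarKernel_self`). -/
noncomputable def kernelTrace {D : Type*} [MeasurableSpace D] (H : Type*) [NormedAddCommGroup H]
    [InnerProductSpace ℂ H] [CompleteSpace H] [RKHS ℂ H D ℂ] (μ : Measure D) : ℝ≥0∞ :=
  ∫⁻ x, ENNReal.ofReal (scalarKernel H x x).re ∂μ

/-- `λ = sup { ‖f‖₂² / ‖f‖_H² : f ∈ H, f ≠ 0 }`, the squared norm of the embedding of `H` into
`L₂(D,μ)`, as an element of `[0,∞]`; it is `0` for `H = 0`. -/
noncomputable def embeddingConst {D : Type*} [MeasurableSpace D] (H : Type*)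
    [NormedAddCommGroup H] [InnerProductSpace ℂ H] [RKHS ℂ H D ℂ] (μ : Measure D) : ℝ≥0∞ :=
  ⨆ (f : H) (_ : f ≠ 0), eLpNorm (⇑f : D → ℂ) 2 μ ^ 2 / ‖f‖ₑ ^ 2

/-- `H` consists of square-integrable functions, is embedded into `L₂(D,μ)` continuously and
injectively, and its kernel has finite trace. -/
structure FiniteTraceEmbedding {D : Type*} [MeasurableSpace D] (H : Type*) [NormedAddCommGroup H]
    [InnerProductSpace ℂ H] [CompleteSpace H] [RKHS ℂ H D ℂ] (μ : Measure D) : Prop where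
  memLp : ∀ f : H, MemLp (⇑f : D → ℂ) 2 μ
  continuous : embeddingConst H μ < ∞
  injective : ∀ f : H, f ≠ 0 → eLpNorm (⇑f : D → ℂ) 2 μ ≠ 0
  finite_trace : kernelTrace H μ < ∞

/-- `g` is a weighted least squares approximation from `V` of the data `y` given at the points `x`
with weights `w`: it minimizes `∑ i, w i * |y i - g (x i)|²` over `V`. -/
def IsWeightedLeastSquares {D H : Type*} [NormedAddCommGroup H] [InnerProductSpace ℂ H]
    [RKHS ℂ H D ℂ] (V : Submodule ℂ H) {n : ℕ} (x : Fin n → D) (w : Fin n → ℝ) (y : Fin n → ℂ)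
    (g : H) : Prop :=
  g ∈ V ∧ ∀ h ∈ V, ∑ i, w i * ‖y i - g (x i)‖ ^ 2 ≤ ∑ i, w i * ‖y i - h (x i)‖ ^ 2

end RKHSRecovery

/-! Put a = P_m f and let g be the least squares fit. Then f - g = (f - a) + (a - g), and the first
term has L₂ norm at most √λ_m ‖f - a‖_H. The samples of a - g are, up to sign, an orthogonal
projection of those of f - a (`IsWeightedLeastSquares.sum_norm_sub_sq_le`). It therefore suffices to
find points and weights with ∑ wᵢ|g(xᵢ)|² ≥ n(1-r)²‖g‖₂² on V and ∑ wᵢ|h(xᵢ)|² ≤ nλ_m(1+s)²‖h‖_H² on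
the complement (`exists_points_weights`).

They are built one point at a time by the barrier method of Batson, Spielman and Srivastava, run
simultaneously on V and on its complement. On either space let b(x) be the kernel function at x and
W = ∫ b b* dμ, whose quadratic form is ‖g‖₂². The sum A of the chosen t b(x)b(x)* is compared with a
barrier that moves by δW per step. If R > 0 is the gap between them, the potential Tr(W R⁻¹) is kept
below a constant c, which forces W ≤ cR; after n steps this is the frame bound.

One step admits (x, t) if 1/t ≤ L(x) for the lower barrier (`lower_barrier_step`) and if U(x) ≤ 1/t
for the upper one (`upper_barrier_step`), with ∫U ≤ 1 ≤ ∫L. Hence some x satisfies both with t =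
1/L(x) (`exists_points_of_strategies`). -/

namespace RKHSRecovery

open InnerProductSpace

/-! ### Positive invertible operators and rank one updates -/

section Operators

variable {E : Type*} [NormedAddCommGroup E] [InnerProductSpace ℂ E]

/-- `R` is a positive bounded operator with bounded inverse `S`. -/
structure IsPosInverse (R S : E →L[ℂ] E) : Prop where
  pos : R.IsPositive
  right : R * S = 1
  left : S * R = 1

namespace IsPosInverse

variable {R S : E →L[ℂ] E}

theorem apply_right (h : IsPosInverse R S) (y : E) : R (S y) = y := by
  simpa using congrArg (fun T : E →L[ℂ] E => T y) h.right

theorem apply_left (h : IsPosInverse R S) (y : E) : S (R y) = y := by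
  simpa using congrArg (fun T : E →L[ℂ] E => T y) h.left

theorem inner_right (h : IsPosInverse R S) (y z : E) : inner ℂ (R y) z = inner ℂ y (R z) :=
  h.pos.isSymmetric y z

theorem inner_inverse (h : IsPosInverse R S) (y z : E) :
    inner ℂ (S y) z = inner ℂ y (S z) := by
  rw [← h.apply_right z, ← h.inner_right, h.apply_right, h.apply_right]

theorem inverse_pos (h : IsPosInverse R S) : S.IsPositive := by
  refine (ContinuousLinearMap.isPositive_iff _).2 ⟨h.inner_inverse, fun y => ?_⟩
  have := h.pos.inner_nonneg_right (S y)
  rwa [h.apply_right] at this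

theorem symm (h : IsPosInverse R S) : IsPosInverse S R := ⟨h.inverse_pos, h.left, h.right⟩

theorem smul (h : IsPosInverse R S) {c : ℝ} (hc : 0 < c) :
    IsPosInverse ((c : ℂ) • R) (((c⁻¹ : ℝ) : ℂ) • S) := by
  have hc' : (c : ℂ) ≠ 0 := by exact_mod_cast hc.ne'
  refine ⟨h.pos.smul_of_nonneg (by exact_mod_cast hc.le), ?_, ?_⟩
  · rw [smul_mul_smul_comm, h.right]; simp [hc']
  · rw [smul_mul_smul_comm, h.left]; simp [hc']

/-- Expand ⟨g - Sy, R(g - Sy)⟩ ≥ 0. This variational form of the inverse serves to compare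
potentials before and after a shift of the barrier. -/
theorem two_re_inner_sub_le (h : IsPosInverse R S) (y g : E) :
    2 * (inner ℂ y g).re - (inner ℂ g (R g)).re ≤ (inner ℂ y (S y)).re := by
  have h0 := h.pos.re_inner_nonneg_right (g - S y)
  have h1 : inner ℂ (S y) (R g) = inner ℂ y g := by rw [← h.inner_right, h.apply_right]
  have h2 : (inner ℂ g y).re = (inner ℂ y g).re := by
    rw [← inner_conj_symm, Complex.conj_re]
  rw [map_sub, h.apply_right, inner_sub_left, inner_sub_right, inner_sub_right, h1,
    h.inner_inverse] at h0
  simp only [RCLike.re_eq_complex_re, Complex.sub_re, h2] at h0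
  linarith

theorem norm_inner_sq_le (h : IsPosInverse R S) (y g : E) :
    ‖inner ℂ y g‖ ^ 2 ≤ (inner ℂ y (S y)).re * (inner ℂ g (R g)).re := by
  set z : ℂ := inner ℂ y g with hz
  set q := (inner ℂ g (R g)).re
  set p := (inner ℂ y (S y)).re
  have hq : 0 ≤ q := h.pos.re_inner_nonneg_right g
  have hp : 0 ≤ p := h.inverse_pos.re_inner_nonneg_right y
  -- The test vector τ z̄ g makes the variational inequality a real quadratic in τ; its discriminant
  -- gives the claim times ‖z‖².
  have key : ∀ τ : ℝ, 0 ≤ ‖z‖ ^ 2 * q * (τ * τ) + -(2 * ‖z‖ ^ 2) * τ + p := by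
    intro τ
    have h1 := h.two_re_inner_sub_le y (((τ : ℂ) * (starRingEnd ℂ) z) • g)
    have h2 : inner ℂ y (((τ : ℂ) * (starRingEnd ℂ) z) • g) = ((τ * ‖z‖ ^ 2 : ℝ) : ℂ) := by
      rw [inner_smul_right, ← hz, mul_assoc, mul_comm _ z, Complex.mul_conj, Complex.normSq_eq_norm_sq]
      push_cast; ring
    have h3 : inner ℂ (((τ : ℂ) * (starRingEnd ℂ) z) • g) (R (((τ : ℂ) * (starRingEnd ℂ) z) • g))
        = ((τ * τ * ‖z‖ ^ 2 : ℝ) : ℂ) * inner ℂ g (R g) := by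
      rw [map_smul, inner_smul_right, inner_smul_left]
      have : z * (starRingEnd ℂ) z = ((‖z‖ ^ 2 : ℝ) : ℂ) := by
        rw [Complex.mul_conj, Complex.normSq_eq_norm_sq]
      simp only [map_mul, Complex.conj_ofReal, Complex.conj_conj]
      push_cast at this ⊢
      linear_combination (τ : ℂ) * τ * inner ℂ g (R g) * this
    rw [h2, h3, Complex.re_ofReal_mul, Complex.ofReal_re] at h1
    change 2 * (τ * ‖z‖ ^ 2) - τ * τ * ‖z‖ ^ 2 * q ≤ p at h1
    linarith
  have hd := discrim_le_zero key
  rw [discrim] at hd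
  rcases (sq_nonneg ‖z‖).eq_or_lt with h0 | h0
  · rw [← h0]; positivity
  · have : ‖z‖ ^ 2 * ‖z‖ ^ 2 ≤ ‖z‖ ^ 2 * (p * q) := by nlinarith
    exact le_of_mul_le_mul_left this h0

theorem inner_inverse_self (h : IsPosInverse R S) (y : E) :
    inner ℂ y (S y) = (((inner ℂ y (S y)).re : ℝ) : ℂ) := by
  have := h.inverse_pos.inner_nonneg_right y
  rw [Complex.le_def] at this
  exact Complex.ext (by simp) (by simpa using this.2.symm)

/-- Sherman–Morrison formula. -/
theorem update_mul (h : IsPosInverse R S) (v : E) {t κ : ℝ} (hκ : κ = (inner ℂ v (S v)).re)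
    (ht : 1 + t * κ ≠ 0) :
    (R + (t : ℂ) • rankOne ℂ v v) * (S - ((t / (1 + t * κ) : ℝ) : ℂ) • rankOne ℂ (S v) (S v)) = 1
    ∧ (S - ((t / (1 + t * κ) : ℝ) : ℂ) • rankOne ℂ (S v) (S v)) * (R + (t : ℂ) • rankOne ℂ v v)
      = 1 := by
  have hk : inner ℂ v (S v) = (κ : ℂ) := by rw [hκ]; exact h.inner_inverse_self v
  have hk' : inner ℂ (S v) v = (κ : ℂ) := by rw [h.inner_inverse, hk]
  have ht' : (1 + t * κ : ℂ) ≠ 0 := by exact_mod_cast ht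
  have hid : (t : ℂ) - (t / (1 + t * κ)) - t * (t / (1 + t * κ)) * κ = 0 := by
    field_simp; ring
  constructor
  · refine ContinuousLinearMap.ext fun y => ?_
    change (R + (t : ℂ) • rankOne ℂ v v)
      ((S - ((t / (1 + t * κ) : ℝ) : ℂ) • rankOne ℂ (S v) (S v)) y) = y
    simp only [add_apply, sub_apply, smul_apply, rankOne_apply, map_sub, map_smul, h.apply_right,
      hk, ← h.inner_inverse]
    push_cast
    match_scalars
    · ring
    · linear_combination (inner ℂ (S v) y) * hid
  · refine ContinuousLinearMap.ext fun y => ?_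
    have hy : inner ℂ (S v) (R y) = inner ℂ v y := by rw [h.inner_inverse, h.apply_left]
    change (S - ((t / (1 + t * κ) : ℝ) : ℂ) • rankOne ℂ (S v) (S v))
      ((R + (t : ℂ) • rankOne ℂ v v) y) = y
    simp only [add_apply, sub_apply, smul_apply, rankOne_apply, map_add, map_smul, h.apply_left,
      hk', hy]
    push_cast
    match_scalars
    · ring
    · linear_combination (inner ℂ v y) * hid

theorem add_rankOne (h : IsPosInverse R S) (v : E) {t : ℝ} (ht : 0 < t) :
    IsPosInverse (R + (t : ℂ) • rankOne ℂ v v)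
      (S - ((t / (1 + t * (inner ℂ v (S v)).re) : ℝ) : ℂ) • rankOne ℂ (S v) (S v)) := by
  have hκ : 0 ≤ (inner ℂ v (S v)).re := h.inverse_pos.re_inner_nonneg_right v
  have h1 : 1 + t * (inner ℂ v (S v)).re ≠ 0 := by positivity
  obtain ⟨h2, h3⟩ := h.update_mul v rfl h1
  exact ⟨h.pos.add ((isPositive_rankOne_self v).smul_of_nonneg (by exact_mod_cast ht.le)), h2, h3⟩

/-- Positivity of the difference is read off its inverse, which is S plus a nonnegative multiple of
a rank one projection. -/
theorem sub_rankOne (h : IsPosInverse R S) (v : E) {t : ℝ} (ht : 0 < t)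
    (hlt : 0 < 1 - t * (inner ℂ v (S v)).re) :
    IsPosInverse (R - (t : ℂ) • rankOne ℂ v v)
      (S + ((t / (1 - t * (inner ℂ v (S v)).re) : ℝ) : ℂ) • rankOne ℂ (S v) (S v)) := by
  have h1 : 1 + (-t) * (inner ℂ v (S v)).re ≠ 0 := by linarith
  obtain ⟨h2, h3⟩ := h.update_mul v rfl h1
  have e1 : R + ((-t : ℝ) : ℂ) • rankOne ℂ v v = R - (t : ℂ) • rankOne ℂ v v := by
    push_cast; rw [neg_smul, sub_eq_add_neg]
  have e2 : S - ((-t / (1 + -t * (inner ℂ v (S v)).re) : ℝ) : ℂ) • rankOne ℂ (S v) (S v)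
      = S + ((t / (1 - t * (inner ℂ v (S v)).re) : ℝ) : ℂ) • rankOne ℂ (S v) (S v) := by
    rw [neg_mul, ← sub_eq_add_neg, neg_div]
    push_cast; rw [neg_smul, sub_neg_eq_add]
  rw [e1, e2] at h2 h3
  refine IsPosInverse.symm ⟨h.inverse_pos.add
    ((isPositive_rankOne_self _).smul_of_nonneg (by exact_mod_cast (by positivity))), h3, h2⟩

theorem exists_add [CompleteSpace E] (h : IsPosInverse R S) {Q : E →L[ℂ] E} (hQ : Q.IsPositive) :
    ∃ P, IsPosInverse (R + Q) P := by
  have hR : IsStrictlyPositive R :=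
    IsUnit.isStrictlyPositive ⟨⟨R, S, h.right, h.left⟩, rfl⟩
      ((ContinuousLinearMap.nonneg_iff_isPositive _).2 h.pos)
  obtain ⟨u, hu⟩ := (hR.add_nonneg ((ContinuousLinearMap.nonneg_iff_isPositive _).2 hQ)).isUnit
  exact ⟨↑u⁻¹, h.pos.add hQ, by rw [← hu, u.mul_inv], by rw [← hu, u.inv_mul]⟩

end IsPosInverse

end Operators

/-! ### Covariance, potential and the two barrier steps -/

section Potential

variable {D E : Type*} [MeasurableSpace D] {μ : Measure D} [NormedAddCommGroup E]
  [InnerProductSpace ℂ E] {b : D → E}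

theorem integrable_inner_apply (hb : MemLp b 2 μ) (A B : E →L[ℂ] E) :
    Integrable (fun x => inner ℂ (A (b x)) (B (b x))) μ := by
  have hA : MemLp (fun x => A (b x)) 2 μ := A.comp_memLp' hb
  have hB : MemLp (fun x => B (b x)) 2 μ := B.comp_memLp' hb
  refine (hA.norm.integrable_mul hB.norm).mono
    (hA.aestronglyMeasurable.inner hB.aestronglyMeasurable) (Filter.Eventually.of_forall fun x => ?_)
  simpa using norm_inner_le_norm (𝕜 := ℂ) (A (b x)) (B (b x))

theorem integrable_re_inner_apply (hb : MemLp b 2 μ) (A B : E →L[ℂ] E) :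
    Integrable (fun x => (inner ℂ (A (b x)) (B (b x))).re) μ :=
  (integrable_inner_apply hb A B).re

theorem integrable_re_inner_self_apply (hb : MemLp b 2 μ) (B : E →L[ℂ] E) :
    Integrable (fun x => (inner ℂ (b x) (B (b x))).re) μ :=
  integrable_re_inner_apply hb 1 B

/-- The barrier potential `∫ ⟨b(x), S b(x)⟩ dμ(x)`, which is the trace of `S` times the
covariance operator of `b`. -/
noncomputable def potential (μ : Measure D) (b : D → E) (S : E →L[ℂ] E) : ℝ :=
  ∫ x, (inner ℂ (b x) (S (b x))).re ∂μ

/-- The covariance operator `∫ b(x) b(x)* dμ(x)`. -/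
noncomputable def covariance (μ : Measure D) (b : D → E) : E →L[ℂ] E :=
  ∫ x, rankOne ℂ (b x) (b x) ∂μ

theorem integrable_rankOne (hb : MemLp b 2 μ) :
    Integrable (fun x => rankOne ℂ (b x) (b x)) μ := by
  have hc : Continuous fun v : E => rankOne ℂ v v := by
    exact (ContinuousLinearMap.smulRightL ℂ E E).continuous₂.comp
      ((innerSL ℂ (E := E)).continuous.prodMk continuous_id)
  refine (hb.norm.integrable_mul hb.norm).mono
    (hc.comp_aestronglyMeasurable hb.aestronglyMeasurable)
    (Filter.Eventually.of_forall fun x => ?_)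
  simp

theorem potential_add_smul (hb : MemLp b 2 μ) (S Q : E →L[ℂ] E) (c : ℝ) :
    potential μ b (S + (c : ℂ) • Q) = potential μ b S + c * potential μ b Q := by
  unfold potential
  rw [← integral_const_mul, ← integral_add (integrable_re_inner_self_apply hb S)
    ((integrable_re_inner_self_apply hb Q).const_mul c)]
  refine integral_congr_ae (Filter.Eventually.of_forall fun x => ?_)
  simp

theorem potential_nonneg {R S : E →L[ℂ] E} (h : IsPosInverse R S) : 0 ≤ potential μ b S :=
  integral_nonneg fun x => h.inverse_pos.re_inner_nonneg_right (b x)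

theorem integrable_norm_inner_sq (hb : MemLp b 2 μ) (g : E) :
    Integrable (fun x => ‖inner ℂ (b x) g‖ ^ 2) μ :=
  (hb.inner_const g).integrable_norm_pow two_ne_zero

variable [CompleteSpace E]

theorem inner_covariance (hb : MemLp b 2 μ) (g h : E) :
    inner ℂ g (covariance μ b h) = ∫ x, inner ℂ g (b x) * inner ℂ (b x) h ∂μ := by
  have hi := integrable_rankOne hb
  rw [covariance, ContinuousLinearMap.integral_apply hi,
    ← integral_inner (hi.apply_continuousLinearMap h)]
  refine integral_congr_ae (Filter.Eventually.of_forall fun x => ?_)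
  simp [inner_smul_right, mul_comm]

theorem inner_covariance_self (hb : MemLp b 2 μ) (g : E) :
    inner ℂ g (covariance μ b g) = ((∫ x, ‖inner ℂ (b x) g‖ ^ 2 ∂μ : ℝ) : ℂ) := by
  rw [inner_covariance hb, ← integral_complex_ofReal]
  refine integral_congr_ae (Filter.Eventually.of_forall fun x => ?_)
  simp only
  rw [← inner_conj_symm g (b x), mul_comm, Complex.mul_conj, Complex.normSq_eq_norm_sq]

theorem re_inner_covariance_self (hb : MemLp b 2 μ) (g : E) :
    (inner ℂ g (covariance μ b g)).re = ∫ x, ‖inner ℂ (b x) g‖ ^ 2 ∂μ := by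
  rw [inner_covariance_self hb, Complex.ofReal_re]

theorem isPositive_covariance (hb : MemLp b 2 μ) : (covariance μ b).IsPositive := by
  rw [ContinuousLinearMap.isPositive_iff_complex]
  intro g
  have h := inner_covariance_self hb g
  have h' : inner ℂ (covariance μ b g) g = ((∫ x, ‖inner ℂ (b x) g‖ ^ 2 ∂μ : ℝ) : ℂ) := by
    rw [← inner_conj_symm, h, Complex.conj_ofReal]
  rw [h']
  exact ⟨by simp, by simpa using integral_nonneg fun x => by positivity⟩

theorem potential_rankOne (hb : MemLp b 2 μ) (g : E) :
    potential μ b (rankOne ℂ g g) = (inner ℂ g (covariance μ b g)).re := by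
  rw [re_inner_covariance_self hb, potential]
  refine integral_congr_ae (Filter.Eventually.of_forall fun x => ?_)
  simp only [rankOne_apply, inner_smul_right]
  rw [← inner_conj_symm g (b x), mul_comm, Complex.mul_conj, Complex.normSq_eq_norm_sq]
  rfl

/-- A bound `φ` on the potential keeps the barrier operator above `φ⁻¹` times the covariance. -/
theorem IsPosInverse.re_inner_covariance_le {R S : E →L[ℂ] E} (h : IsPosInverse R S)
    (hb : MemLp b 2 μ) (g : E) :
    (inner ℂ g (covariance μ b g)).re ≤ potential μ b S * (inner ℂ g (R g)).re := by
  rw [re_inner_covariance_self hb, potential, ← integral_mul_const]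
  exact integral_mono (integrable_norm_inner_sq hb g)
    ((integrable_re_inner_self_apply hb S).mul_const _) fun x => h.norm_inner_sq_le (b x) g

theorem isPositive_smul_sub_covariance {R S : E →L[ℂ] E} (h : IsPosInverse R S)
    (hb : MemLp b 2 μ) {φ : ℝ} (hφ : potential μ b S ≤ φ) :
    ((φ : ℂ) • R - covariance μ b).IsPositive := by
  have hW := isPositive_covariance hb
  refine (ContinuousLinearMap.isPositive_iff_complex _).2 fun g => ?_
  have e1 : inner ℂ (((φ : ℂ) • R - covariance μ b) g) g
      = (φ : ℂ) * inner ℂ g (R g) - inner ℂ g (covariance μ b g) := by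
    rw [sub_apply, smul_apply, inner_sub_left, inner_smul_left, Complex.conj_ofReal,
      h.inner_right, hW.inner_left_eq_inner_right]
  have e2 : inner ℂ g (R g) = (((inner ℂ g (R g)).re : ℝ) : ℂ) := h.symm.inner_inverse_self g
  have hp : 0 ≤ (inner ℂ g (R g)).re := h.pos.re_inner_nonneg_right g
  have hle := h.re_inner_covariance_le hb g
  have e3 : inner ℂ g (covariance μ b g) = (((inner ℂ g (covariance μ b g)).re : ℝ) : ℂ) := by
    rw [re_inner_covariance_self hb, inner_covariance_self hb]
  rw [e1, e2, e3]
  constructor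
  · simp
  · have : (inner ℂ g (covariance μ b g)).re ≤ φ * (inner ℂ g (R g)).re :=
      hle.trans (by gcongr)
    simpa using this

/-- If the integral vanished, injectivity of W would give S b = 0, hence b = 0, almost everywhere,
so W = 0. Positivity permits the divisions in the barrier steps. -/
theorem integral_covariance_pos [Nontrivial E] (hb : MemLp b 2 μ)
    (hinj : ∀ g : E, (inner ℂ g (covariance μ b g)).re = 0 → g = 0) {R S : E →L[ℂ] E}
    (h : IsPosInverse R S) :
    0 < ∫ x, (inner ℂ (S (b x)) (covariance μ b (S (b x)))).re ∂μ := by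
  have h0 : ∀ x, 0 ≤ (inner ℂ (S (b x)) (covariance μ b (S (b x)))).re := fun x =>
    (isPositive_covariance hb).re_inner_nonneg_right _
  refine (integral_nonneg h0).lt_of_ne fun heq => ?_
  have hz := (integral_eq_zero_iff_of_nonneg h0
    (integrable_re_inner_apply hb S ((covariance μ b) * S))).1 heq.symm
  have hb0 : ∀ᵐ x ∂μ, b x = 0 := by
    filter_upwards [hz] with x hx
    have := hinj _ hx
    rw [← h.apply_right (b x), this, map_zero]
  obtain ⟨g, hg⟩ := exists_ne (0 : E)
  refine hg (hinj g ?_)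
  rw [re_inner_covariance_self hb]
  refine integral_eq_zero_of_ae ?_
  filter_upwards [hb0] with x hx
  simp [hx]

/-- One step of the upper barrier argument. -/
theorem upper_barrier_step [Nontrivial E] (hb : MemLp b 2 μ)
    (hinj : ∀ g : E, (inner ℂ g (covariance μ b g)).re = 0 → g = 0) {R S : E →L[ℂ] E}
    (h : IsPosInverse R S) {ψ δ : ℝ} (hψ : potential μ b S ≤ ψ) (hδ : 0 < δ) (hδψ : 1 / δ + ψ ≤ 1) :
    ∃ U : D → ℝ, Integrable U μ ∧ (∀ x, 0 ≤ U x) ∧ ∫ x, U x ∂μ ≤ 1 ∧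
      ∀ x t, 0 < t → U x ≤ 1 / t →
        ∃ S', IsPosInverse (R + (δ : ℂ) • covariance μ b - (t : ℂ) • rankOne ℂ (b x) (b x)) S' ∧
          potential μ b S' ≤ ψ := by
  set W := covariance μ b with hWdef
  have hW : W.IsPositive := isPositive_covariance hb
  obtain ⟨P, hP⟩ := h.exists_add (hW.smul_of_nonneg (c := (δ : ℂ)) (by exact_mod_cast hδ.le))
  set E₀ := ∫ x, (inner ℂ (P (b x)) (W (P (b x)))).re ∂μ with hE₀
  have hE₀pos : 0 < E₀ := integral_covariance_pos hb hinj hP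
  have hw0 : ∀ x, 0 ≤ (inner ℂ (P (b x)) (W (P (b x)))).re := fun x => hW.re_inner_nonneg_right _
  have hκ0 : ∀ x, 0 ≤ (inner ℂ (b x) (P (b x))).re := fun x => hP.inverse_pos.re_inner_nonneg_right _
  have hiw : Integrable (fun x => (inner ℂ (P (b x)) (W (P (b x)))).re) μ :=
    integrable_re_inner_apply hb P (W * P)
  have hiκ := integrable_re_inner_self_apply hb P
  -- Shifting the barrier by δW gains at least δE₀ of potential: the variational inequality for S,
  -- tested at g = P b(x).
  have hdrop : potential μ b P + δ * E₀ ≤ potential μ b S := by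
    unfold potential
    rw [hE₀, ← integral_const_mul, ← integral_add hiκ (hiw.const_mul δ)]
    refine integral_mono (hiκ.add (hiw.const_mul δ)) (integrable_re_inner_self_apply hb S)
      fun x => ?_
    have h1 := h.two_re_inner_sub_le (b x) (P (b x))
    have h2 : (inner ℂ (P (b x)) (R (P (b x)))).re + δ * (inner ℂ (P (b x)) (W (P (b x)))).re
        = (inner ℂ (b x) (P (b x))).re := by
      have h3 := hP.apply_right (b x)
      rw [add_apply, smul_apply] at h3
      rw [← hP.inner_inverse, ← Complex.re_ofReal_mul, ← inner_smul_right, ← Complex.add_re,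
        ← inner_add_right, h3]
    simp only
    linarith
  -- Subtracting t b b* raises the potential by tw/(1 - tκ); U x ≤ 1/t says exactly that this does
  -- not exceed the gain δE₀.
  refine ⟨fun x => (inner ℂ (P (b x)) (W (P (b x)))).re / (δ * E₀) + (inner ℂ (b x) (P (b x))).re,
    (hiw.div_const _).add hiκ, fun x => ?_, ?_, fun x t ht hU => ?_⟩
  · have := hw0 x; have := hκ0 x; positivity
  · rw [integral_add (hiw.div_const _) hiκ, integral_div, ← hE₀]
    have : E₀ / (δ * E₀) = 1 / δ := by field_simp
    rw [this]
    change 1 / δ + potential μ b P ≤ 1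
    have : 0 ≤ δ * E₀ := by positivity
    linarith
  · set w := (inner ℂ (P (b x)) (W (P (b x)))).re with hw
    set κ := (inner ℂ (b x) (P (b x))).re with hκ
    have hw0' : 0 ≤ w := hw0 x
    have hκ0' : 0 ≤ κ := hκ0 x
    have hδE : 0 < δ * E₀ := by positivity
    have hU' : t * w ≤ (1 - t * κ) * (δ * E₀) := by
      have h1 : w / (δ * E₀) ≤ 1 / t - κ := by simp only at hU; linarith
      rw [div_le_iff₀ hδE] at h1
      have h2 := mul_le_mul_of_nonneg_left h1 ht.le
      have h3 : t * ((1 / t - κ) * (δ * E₀)) = (1 - t * κ) * (δ * E₀) := by field_simp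
      linarith
    -- In the boundary case tκ = 1 one gets w = 0, so P b(x) = 0 by injectivity and κ = 0, a
    -- contradiction.
    have h1 : 0 < 1 - t * κ := by
      have hge : 0 ≤ 1 - t * κ := by
        by_contra hneg
        push Not at hneg
        have := mul_neg_of_neg_of_pos hneg hδE
        have : 0 ≤ t * w := by positivity
        linarith
      refine hge.lt_of_ne fun h0 => ?_
      rw [← h0, zero_mul] at hU'
      have hw00 : w = 0 := le_antisymm (by by_contra hc; push Not at hc; nlinarith) hw0'
      have hPb : P (b x) = 0 := hinj _ hw00
      have : κ = 0 := by rw [hκ, hPb]; simp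
      rw [this] at h0
      norm_num at h0
    refine ⟨_, hP.sub_rankOne (b x) ht h1, ?_⟩
    rw [potential_add_smul hb, potential_rankOne hb]
    have h2 : t / (1 - t * κ) * w ≤ δ * E₀ := by
      rw [div_mul_eq_mul_div, div_le_iff₀ h1]; linarith
    change potential μ b P + t / (1 - t * κ) * w ≤ ψ
    linarith

/-- One step of the lower barrier argument. -/
theorem lower_barrier_step [Nontrivial E] (hb : MemLp b 2 μ)
    (hinj : ∀ g : E, (inner ℂ g (covariance μ b g)).re = 0 → g = 0) {R S : E →L[ℂ] E}
    (h : IsPosInverse R S) {φ δ : ℝ} (hφ : potential μ b S ≤ φ) (hδ : 0 < δ) (hδφ : δ * φ < 1)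
    (hL : 1 ≤ 1 / δ - φ) :
    ∃ L : D → ℝ, Integrable L μ ∧ 1 ≤ ∫ x, L x ∂μ ∧
      ∀ x t, 0 < t → 1 / t ≤ L x →
        ∃ S', IsPosInverse (R - (δ : ℂ) • covariance μ b + (t : ℂ) • rankOne ℂ (b x) (b x)) S' ∧
          potential μ b S' ≤ φ := by
  set W := covariance μ b with hWdef
  have hW : W.IsPositive := isPositive_covariance hb
  -- R - δW = (1 - δφ)R + δ(φR - W), a positive invertible operator plus a positive one.
  obtain ⟨P, hP⟩ : ∃ P, IsPosInverse (R - (δ : ℂ) • W) P := by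
    obtain ⟨P, hP⟩ := (h.smul (c := 1 - δ * φ) (by linarith)).exists_add
      ((isPositive_smul_sub_covariance h hb hφ).smul_of_nonneg (c := (δ : ℂ))
        (by exact_mod_cast hδ.le))
    refine ⟨P, ?_⟩
    convert hP using 1
    push_cast
    module
  set p := potential μ b P with hp
  set q := potential μ b S with hq
  set E₀ := ∫ x, (inner ℂ (P (b x)) (W (P (b x)))).re ∂μ with hE₀
  have hiw : Integrable (fun x => (inner ℂ (P (b x)) (W (P (b x)))).re) μ :=
    integrable_re_inner_apply hb P (W * P)
  have his : Integrable (fun x => (inner ℂ (S (b x)) (W (S (b x)))).re) μ :=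
    integrable_re_inner_apply hb S (W * S)
  have hiκ := integrable_re_inner_self_apply hb P
  have hiσ := integrable_re_inner_self_apply hb S
  have hRW : ∀ y, R y = (R - (δ : ℂ) • W) y + (δ : ℂ) • W y := fun y => by
    rw [sub_apply, smul_apply]; abel
  have hΔ : 0 < p - q := by
    have hpos := integral_covariance_pos hb hinj h
    have : q + δ * ∫ x, (inner ℂ (S (b x)) (W (S (b x)))).re ∂μ ≤ p := by
      rw [hp, hq]
      unfold potential
      rw [← integral_const_mul, ← integral_add hiσ (his.const_mul δ)]
      refine integral_mono (hiσ.add (his.const_mul δ)) hiκ fun x => ?_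
      have h1 := hP.two_re_inner_sub_le (b x) (S (b x))
      have h2 : (inner ℂ (S (b x)) ((R - (δ : ℂ) • W) (S (b x)))).re
          = (inner ℂ (b x) (S (b x))).re - δ * (inner ℂ (S (b x)) (W (S (b x)))).re := by
        rw [sub_apply, smul_apply, h.apply_right, inner_sub_right, inner_smul_right,
          Complex.sub_re, Complex.re_ofReal_mul, h.inner_inverse]
      simp only
      linarith
    have : 0 < δ * ∫ x, (inner ℂ (S (b x)) (W (S (b x)))).re ∂μ := mul_pos hδ hpos
    linarith
  -- The variational inequality for S at y = (1 + θ)b, g = P b, integrated; θ stays free to be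
  -- optimized.
  have hθ : ∀ θ : ℝ, (1 + 2 * θ) * p - δ * E₀ ≤ (1 + θ) ^ 2 * q := by
    intro θ
    rw [hp, hq, hE₀]
    unfold potential
    rw [← integral_const_mul, ← integral_const_mul, ← integral_const_mul,
      ← integral_sub (hiκ.const_mul _) (hiw.const_mul δ)]
    refine integral_mono ((hiκ.const_mul _).sub (hiw.const_mul δ)) (hiσ.const_mul _) fun x => ?_
    have h1 := h.two_re_inner_sub_le (((1 + θ : ℝ) : ℂ) • b x) (P (b x))
    have h2 : (inner ℂ (P (b x)) (R (P (b x)))).re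
        = (inner ℂ (b x) (P (b x))).re + δ * (inner ℂ (P (b x)) (W (P (b x)))).re := by
      rw [hRW, hP.apply_right, inner_add_right, inner_smul_right, Complex.add_re,
        Complex.re_ofReal_mul, hP.inner_inverse]
    rw [inner_smul_left, map_smul, inner_smul_left, inner_smul_right, Complex.conj_ofReal,
      Complex.re_ofReal_mul, Complex.re_ofReal_mul, Complex.re_ofReal_mul, h2] at h1
    simp only
    linarith
  have hq0 : 0 ≤ q := potential_nonneg h
  have hE : (p - q) * (1 / δ + (p - q)) ≤ E₀ := by
    have h1 := hθ (δ * (p - q))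
    have h2 : δ * q ≤ 1 := (mul_le_mul_of_nonneg_left hφ hδ.le).trans hδφ.le
    have h3 : δ * (p - q) ^ 2 * (δ * q) ≤ δ * (p - q) ^ 2 * 1 := by gcongr
    have h4 : (p - q) * (1 / δ + (p - q)) = ((p - q) + δ * (p - q) ^ 2) / δ := by
      field_simp
    rw [h4, div_le_iff₀ hδ]
    nlinarith
  -- Adding t b b* lowers the potential by tw/(1 + tκ), which undoes the increase p - q once 1/t ≤ L
  -- x. By `hE`, ∫L ≥ 1/δ - q ≥ 1/δ - φ ≥ 1.
  refine ⟨fun x => (inner ℂ (P (b x)) (W (P (b x)))).re / (p - q) - (inner ℂ (b x) (P (b x))).re,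
    (hiw.div_const _).sub hiκ, ?_, fun x t ht hLt => ?_⟩
  · rw [integral_sub (hiw.div_const _) hiκ, integral_div, ← hE₀]
    change 1 ≤ E₀ / (p - q) - p
    have : 1 / δ + (p - q) ≤ E₀ / (p - q) := by rw [le_div_iff₀ hΔ]; linarith
    linarith
  · set w := (inner ℂ (P (b x)) (W (P (b x)))).re with hw
    set κ := (inner ℂ (b x) (P (b x))).re with hκ
    have hκ0 : 0 ≤ κ := hP.inverse_pos.re_inner_nonneg_right _
    refine ⟨_, hP.add_rankOne (b x) ht, ?_⟩
    have e : ∀ c : ℝ, P - (c : ℂ) • rankOne ℂ (P (b x)) (P (b x))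
        = P + ((-c : ℝ) : ℂ) • rankOne ℂ (P (b x)) (P (b x)) := fun c => by
      push_cast; rw [neg_smul, sub_eq_add_neg]
    rw [e, potential_add_smul hb, potential_rankOne hb]
    change p + -(t / (1 + t * κ)) * w ≤ φ
    have h1 : 0 < 1 + t * κ := by positivity
    have h2 : p - q ≤ t / (1 + t * κ) * w := by
      rw [div_mul_eq_mul_div, le_div_iff₀ h1]
      have h3 : 1 / t + κ ≤ w / (p - q) := by simp only at hLt; linarith
      rw [le_div_iff₀ hΔ] at h3
      have h4 := mul_le_mul_of_nonneg_left h3 ht.le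
      have h5 : t * ((1 / t + κ) * (p - q)) = (p - q) * (1 + t * κ) := by field_simp
      linarith
    linarith

end Potential

/-! ### Choosing points that serve both barriers -/

section Strategies

variable {D E F : Type*} [MeasurableSpace D] {μ : Measure D}
  [NormedAddCommGroup E] [InnerProductSpace ℂ E] [NormedAddCommGroup F] [InnerProductSpace ℂ F]
  {b : D → E} {c : D → F}

/-- The property `p k A` of sums of `k` weighted rank one operators `t b(x) b(x)*` starts at the
empty sum and survives adding a point `x` whose weight satisfies `1 / t ≤ L x`, for some `L` of
integral at least one depending on `k` and `A`. -/
def IsLowerStrategy (μ : Measure D) (b : D → E) (p : ℕ → (E →L[ℂ] E) → Prop) : Prop :=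
  p 0 0 ∧ ∀ k A, p k A → ∃ L : D → ℝ, Integrable L μ ∧ 1 ≤ ∫ x, L x ∂μ ∧
    ∀ x t, 0 < t → 1 / t ≤ L x → p (k + 1) (A + (t : ℂ) • rankOne ℂ (b x) (b x))

/-- The property `p k A` of sums of `k` weighted rank one operators `t b(x) b(x)*` starts at the
empty sum and survives adding a point `x` whose weight satisfies `U x ≤ 1 / t`, for some
nonnegative `U` of integral at most one depending on `k` and `A`. -/
def IsUpperStrategy (μ : Measure D) (b : D → E) (p : ℕ → (E →L[ℂ] E) → Prop) : Prop :=
  p 0 0 ∧ ∀ k A, p k A → ∃ U : D → ℝ, Integrable U μ ∧ (∀ x, 0 ≤ U x) ∧ ∫ x, U x ∂μ ≤ 1 ∧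
    ∀ x t, 0 < t → U x ≤ 1 / t → p (k + 1) (A + (t : ℂ) • rankOne ℂ (b x) (b x))

/-- Otherwise L ≤ U everywhere, as U ≥ 0; the integrals then force U = L, hence L ≤ 0, almost
everywhere, against ∫L ≥ 1. Positivity of L x makes 1 / L x a weight. -/
theorem exists_le_and_pos {U L : D → ℝ} (hU : Integrable U μ) (hL : Integrable L μ)
    (hU0 : ∀ x, 0 ≤ U x) (hU1 : ∫ x, U x ∂μ ≤ 1) (hL1 : 1 ≤ ∫ x, L x ∂μ) :
    ∃ x, U x ≤ L x ∧ 0 < L x := by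
  by_contra! hcon
  have hle : ∀ x, L x ≤ U x := fun x => by
    by_contra! hlt
    exact absurd (hcon x hlt.le) (not_le.2 ((hU0 x).trans_lt hlt))
  have hint : ∫ x, (U x - L x) ∂μ = 0 := by
    refine le_antisymm ?_ (integral_nonneg fun x => sub_nonneg.2 (hle x))
    rw [integral_sub hU hL]; linarith
  have hae := (integral_eq_zero_iff_of_nonneg (fun x => sub_nonneg.2 (hle x)) (hU.sub hL)).1 hint
  have : ∫ x, L x ∂μ ≤ 0 := by
    refine integral_nonpos_of_ae ?_
    filter_upwards [hae] with x hx
    simp only [Pi.zero_apply] at hx ⊢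
    exact hcon x (by linarith)
  linarith

theorem exists_points_of_strategies {p : ℕ → (E →L[ℂ] E) → Prop} {q : ℕ → (F →L[ℂ] F) → Prop}
    (hp : IsLowerStrategy μ b p) (hq : IsUpperStrategy μ c q) (n : ℕ) :
    ∃ (x : Fin n → D) (t : Fin n → ℝ), (∀ i, 0 < t i) ∧
      p n (∑ i, (t i : ℂ) • rankOne ℂ (b (x i)) (b (x i))) ∧
      q n (∑ i, (t i : ℂ) • rankOne ℂ (c (x i)) (c (x i))) := by
  induction n with
  | zero => exact ⟨Fin.elim0, Fin.elim0, fun i => i.elim0, by simpa using hp.1, by simpa using hq.1⟩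
  | succ n ih =>
    obtain ⟨x, t, ht, hpn, hqn⟩ := ih
    obtain ⟨L, hLi, hL1, hL⟩ := hp.2 _ _ hpn
    obtain ⟨U, hUi, hU0, hU1, hU⟩ := hq.2 _ _ hqn
    obtain ⟨y, hy, hy0⟩ := exists_le_and_pos hUi hLi hU0 hU1 hL1
    refine ⟨Fin.snoc x y, Fin.snoc t (1 / L y), fun i => ?_, ?_, ?_⟩
    · refine Fin.lastCases ?_ (fun j => ?_) i
      · simpa using hy0
      · simpa using ht j
    · simpa only [Fin.sum_univ_castSucc, Fin.snoc_castSucc, Fin.snoc_last] using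
        hL y (1 / L y) (by positivity) (by simp)
    · simpa only [Fin.sum_univ_castSucc, Fin.snoc_castSucc, Fin.snoc_last] using
        hU y (1 / L y) (by positivity) (by simpa using hy)

theorem re_inner_smul_rankOne (t : ℝ) (v g : E) :
    (inner ℂ g (((t : ℂ) • rankOne ℂ v v) g)).re = t * ‖inner ℂ v g‖ ^ 2 := by
  rw [smul_apply, rankOne_apply, inner_smul_right, inner_smul_right, ← inner_conj_symm g v,
    Complex.mul_conj, Complex.normSq_eq_norm_sq, ← Complex.ofReal_mul, Complex.ofReal_re]

theorem re_inner_sum_smul_rankOne {n : ℕ} (t : Fin n → ℝ) (v : Fin n → E) (g : E) :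
    (inner ℂ g ((∑ i, (t i : ℂ) • rankOne ℂ (v i) (v i)) g)).re
      = ∑ i, t i * ‖inner ℂ (v i) g‖ ^ 2 := by
  rw [sum_apply, inner_sum, Complex.re_sum]
  exact Finset.sum_congr rfl fun i _ => re_inner_smul_rankOne _ _ _

theorem re_inner_real_smul (t : ℝ) (g h : E) : (inner ℂ g ((t : ℂ) • h)).re
    = t * (inner ℂ g h).re := by
  rw [inner_smul_right, Complex.re_ofReal_mul]

/-! ### Lower frame bound in finite dimension -/

section Lower

variable [FiniteDimensional ℂ E] [CompleteSpace E]

/-- The potential of W⁻¹ is the trace of the identity, computed in an orthonormal basis. -/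
theorem exists_inverse_covariance (hb : MemLp b 2 μ)
    (hinj : ∀ g : E, (inner ℂ g (covariance μ b g)).re = 0 → g = 0) :
    ∃ S, IsPosInverse (covariance μ b) S ∧ potential μ b S = Module.finrank ℂ E := by
  have hW := isPositive_covariance hb
  have hker : Function.Injective (covariance μ b : E →ₗ[ℂ] E) := by
    rw [← LinearMap.ker_eq_bot, LinearMap.ker_eq_bot']
    intro g hg
    refine hinj g ?_
    have : covariance μ b g = 0 := hg
    rw [this]; simp
  let e := LinearEquiv.ofInjectiveEndo (covariance μ b : E →ₗ[ℂ] E) hker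
  let S : E →L[ℂ] E := LinearMap.toContinuousLinearMap (e.symm : E →ₗ[ℂ] E)
  have hS : IsPosInverse (covariance μ b) S := by
    refine ⟨hW, ContinuousLinearMap.ext fun y => ?_, ContinuousLinearMap.ext fun y => ?_⟩
    · exact e.apply_symm_apply y
    · exact e.symm_apply_apply y
  refine ⟨S, hS, ?_⟩
  let f := stdOrthonormalBasis ℂ E
  have h1 : ∀ x, inner ℂ (b x) (S (b x)) = ∑ i, inner ℂ (S (f i)) (b x) * inner ℂ (b x) (f i) := by
    intro x
    rw [← f.sum_inner_mul_inner]
    refine Finset.sum_congr rfl fun i _ => ?_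
    rw [hS.inner_inverse, mul_comm]
  have hi : ∀ i, Integrable (fun x => inner ℂ (S (f i)) (b x) * inner ℂ (b x) (f i)) μ :=
    fun i => (hb.const_inner _).integrable_mul (hb.inner_const _)
  have h2 : ∫ x, inner ℂ (b x) (S (b x)) ∂μ = (Module.finrank ℂ E : ℂ) := by
    simp_rw [h1]
    rw [integral_finsetSum _ fun i _ => hi i]
    have : ∀ i, ∫ x, inner ℂ (S (f i)) (b x) * inner ℂ (b x) (f i) ∂μ = 1 := fun i => by
      rw [← inner_covariance hb, hS.inner_inverse, hS.apply_left, inner_self_eq_norm_sq_to_K]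
      simp
    simp [this]
  have h3 := congrArg Complex.re h2
  have h4 := integral_re (integrable_inner_apply hb 1 S)
  change ∫ x, (inner ℂ (b x) (S (b x))).re ∂μ = (∫ x, inner ℂ (b x) (S (b x)) ∂μ).re at h4
  rw [potential, h4, h3]
  simp

theorem exists_lowerStrategy_of_pos (hb : MemLp b 2 μ)
    (hinj : ∀ g : E, (inner ℂ g (covariance μ b g)).re = 0 → g = 0) {n : ℕ} {r : ℝ}
    (hr0 : 0 < r) (hr1 : r < 1) (hr : (Module.finrank ℂ E : ℝ) - 1 = n * r ^ 2) :
    ∃ p, IsLowerStrategy μ b p ∧ ∀ A, p n A → ∀ g,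
      n * (1 - r) ^ 2 * (inner ℂ g (covariance μ b g)).re ≤ (inner ℂ g (A g)).re := by
  obtain ⟨P, hP, hPpot⟩ := exists_inverse_covariance hb hinj
  set W := covariance μ b with hW
  set m : ℝ := (Module.finrank ℂ E : ℝ) with hm
  have hm1 : 1 ≤ m := by
    have : 0 ≤ n * r ^ 2 := by positivity
    linarith
  have hnt : Nontrivial E := by
    refine Module.nontrivial_of_finrank_pos (R := ℂ) ?_
    have : (0 : ℝ) < (Module.finrank ℂ E : ℝ) := by linarith
    exact_mod_cast this
  have h1r : 0 < 1 - r := by linarith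
  set φ := r / (1 - r) with hφ
  have hφ0 : 0 < φ := by positivity
  -- The shift δ = 1 - r and the bound φ = r/(1 - r) satisfy 1/δ - φ = 1 and δφ = r; the initial gap
  -- (m/φ)W has potential exactly φ.
  refine ⟨fun k A => ∃ S, IsPosInverse (A + ((m / φ - k * (1 - r) : ℝ) : ℂ) • W) S ∧
    potential μ b S ≤ φ, ⟨⟨((φ / m : ℝ) : ℂ) • P, ?_, ?_⟩, ?_⟩, ?_⟩
  · have := hP.smul (c := m / φ) (by positivity)
    simpa using this
  · have := potential_add_smul hb 0 P (φ / m)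
    rw [zero_add, hPpot] at this
    rw [this]
    have h0 : potential μ b (0 : E →L[ℂ] E) = 0 := by simp [potential]
    rw [h0, zero_add, div_mul_cancel₀ _ (by positivity)]
  · rintro k A ⟨S, hS, hSφ⟩
    obtain ⟨L, hLi, hL1, hL⟩ := lower_barrier_step hb hinj hS hSφ h1r
      (by rw [hφ, mul_div_cancel₀ _ h1r.ne']; exact hr1)
      (by rw [hφ, ← sub_div, div_self h1r.ne'])
    refine ⟨L, hLi, hL1, fun x t ht htL => ?_⟩
    obtain ⟨S', hS', hS'φ⟩ := hL x t ht htL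
    refine ⟨S', ?_, hS'φ⟩
    convert hS' using 1
    push_cast
    module
  · rintro A ⟨S, hS, hSφ⟩ g
    have h1 := hS.re_inner_covariance_le hb g
    have h2 : (inner ℂ g ((A + ((m / φ - n * (1 - r) : ℝ) : ℂ) • W) g)).re
        = (inner ℂ g (A g)).re + (m / φ - n * (1 - r)) * (inner ℂ g (W g)).re := by
      rw [add_apply, smul_apply, inner_add_right, Complex.add_re, re_inner_real_smul]
    have h3 := h1.trans (mul_le_mul_of_nonneg_right hSφ (hS.pos.re_inner_nonneg_right g))
    change _ ≤ φ * (inner ℂ g ((A + ((m / φ - n * (1 - r) : ℝ) : ℂ) • W) g)).re at h3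
    rw [h2] at h3
    change (inner ℂ g (W g)).re ≤ _ at h3
    set w := (inner ℂ g (W g)).re
    set a := (inner ℂ g (A g)).re
    -- W ≤ φR gives φA ≥ (1 - m + nr)W, and m = 1 + nr² turns the factor into nr(1 - r) = φn(1 -
    -- r)².
    have h4 : φ * (n * (1 - r) ^ 2 * w) ≤ φ * a := by
      have e1 : φ * (a + (m / φ - n * (1 - r)) * w) = φ * a + (m - n * ((1 - r) * φ)) * w := by
        field_simp
      have e2 : (1 - r) * φ = r := by rw [hφ, mul_div_cancel₀ _ h1r.ne']
      have e3 : φ * (n * (1 - r) ^ 2 * w) = n * (1 - r) * ((1 - r) * φ) * w := by ring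
      rw [e1, e2] at h3
      rw [e3, e2]
      have e4 : m = 1 + n * r ^ 2 := by linarith
      rw [e4] at h3
      nlinarith
    exact le_of_mul_le_mul_left h4 hφ0

/-- Here r = 0 and the barrier degenerates (φ = 0). On a line all quadratic forms are proportional,
so testing on one vector suffices. -/
theorem exists_lowerStrategy_of_finrank_eq_one (hb : MemLp b 2 μ)
    (hinj : ∀ g : E, (inner ℂ g (covariance μ b g)).re = 0 → g = 0) (n : ℕ)
    (hE : Module.finrank ℂ E = 1) :
    ∃ p, IsLowerStrategy μ b p ∧ ∀ A, p n A → ∀ g,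
      n * (inner ℂ g (covariance μ b g)).re ≤ (inner ℂ g (A g)).re := by
  obtain ⟨e, he, hspan⟩ := finrank_eq_one_iff'.1 hE
  have hW := isPositive_covariance hb
  set ω := (inner ℂ e (covariance μ b e)).re with hω
  have hω0 : 0 < ω :=
    lt_of_le_of_ne (hW.re_inner_nonneg_right e) fun h => he (hinj e h.symm)
  refine ⟨fun k A => ∀ g, k * (inner ℂ g (covariance μ b g)).re ≤ (inner ℂ g (A g)).re,
    ⟨fun g => by simp, fun k A hA => ⟨fun x => ‖inner ℂ (b x) e‖ ^ 2 / ω,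
      (integrable_norm_inner_sq hb e).div_const _, ?_, fun x t ht htL g => ?_⟩⟩, fun A hA => hA⟩
  · rw [integral_div, ← re_inner_covariance_self hb, ← hω, div_self hω0.ne']
  · obtain ⟨γ, rfl⟩ := hspan g
    have h1 : (inner ℂ (γ • e) (covariance μ b (γ • e))).re = ‖γ‖ ^ 2 * ω := by
      rw [re_inner_covariance_self hb, hω, re_inner_covariance_self hb, ← integral_const_mul]
      simp_rw [inner_smul_right, norm_mul, mul_pow]
    have h2 := hA (γ • e)
    rw [add_apply, inner_add_right, Complex.add_re, re_inner_smul_rankOne, inner_smul_right,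
      norm_mul, mul_pow]
    rw [h1] at h2 ⊢
    have h3 : ω ≤ t * ‖inner ℂ (b x) e‖ ^ 2 := by
      simp only at htL
      rw [div_le_div_iff₀ ht hω0] at htL; linarith
    have h4 := mul_le_mul_of_nonneg_left h3 (sq_nonneg ‖γ‖)
    push_cast
    linarith

theorem exists_lowerStrategy (hb : MemLp b 2 μ)
    (hinj : ∀ g : E, (inner ℂ g (covariance μ b g)).re = 0 → g = 0) {n : ℕ} {r : ℝ}
    (hr0 : 0 ≤ r) (hr1 : r < 1)
    (hr : (Module.finrank ℂ E : ℝ) - 1 = n * r ^ 2) :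
    ∃ p, IsLowerStrategy μ b p ∧ ∀ A, p n A → ∀ g,
      n * (1 - r) ^ 2 * (inner ℂ g (covariance μ b g)).re ≤ (inner ℂ g (A g)).re := by
  rcases hr0.eq_or_lt with h | h
  · subst h
    have : Module.finrank ℂ E = 1 := by
      have : (Module.finrank ℂ E : ℝ) = 1 := by linarith [hr.trans (by simp : n * (0 : ℝ) ^ 2 = 0)]
      exact_mod_cast this
    simpa using exists_lowerStrategy_of_finrank_eq_one hb hinj n this
  · exact exists_lowerStrategy_of_pos hb hinj h hr1 hr

end Lower

/-! ### Upper frame bound on the complement -/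

section Upper

theorem exists_upperStrategy_of_pos (hb : MemLp b 2 μ) (n : ℕ) (hT : 0 < ∫ x, ‖b x‖ ^ 2 ∂μ) :
    ∃ p, IsUpperStrategy μ b p ∧ ∀ A, p n A → ∀ g : E,
      (inner ℂ g (A g)).re ≤ n * (∫ x, ‖b x‖ ^ 2 ∂μ) * ‖g‖ ^ 2 := by
  set T := ∫ x, ‖b x‖ ^ 2 ∂μ with hTdef
  refine ⟨fun k A => ∀ g : E, (inner ℂ g (A g)).re ≤ k * T * ‖g‖ ^ 2,
    ⟨fun g => by simp, fun k A hA => ⟨fun x => ‖b x‖ ^ 2 / T,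
      (hb.integrable_norm_pow two_ne_zero).div_const _, fun x => by positivity, ?_,
      fun x t ht htU g => ?_⟩⟩, fun A hA => hA⟩
  · rw [integral_div, ← hTdef, div_self hT.ne']
  · rw [add_apply, inner_add_right, Complex.add_re, re_inner_smul_rankOne]
    have h1 : t * ‖b x‖ ^ 2 ≤ T := by
      simp only at htU
      rw [div_le_div_iff₀ hT ht] at htU; linarith
    have h2 : ‖inner ℂ (b x) g‖ ^ 2 ≤ ‖b x‖ ^ 2 * ‖g‖ ^ 2 := by
      rw [← mul_pow]; gcongr; exact norm_inner_le_norm _ _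
    have h3 := mul_le_mul_of_nonneg_left h2 ht.le
    have h4 := mul_le_mul_of_nonneg_right h1 (sq_nonneg ‖g‖)
    have := hA g
    push_cast
    linarith

theorem potential_one : potential μ b 1 = ∫ x, ‖b x‖ ^ 2 ∂μ := by
  unfold potential
  refine integral_congr_ae (Filter.Eventually.of_forall fun x => ?_)
  exact inner_self_eq_norm_sq (𝕜 := ℂ) (b x)

variable [CompleteSpace E]

theorem exists_upperStrategy_of_one_le [Nontrivial E] (hb : MemLp b 2 μ)
    (hinj : ∀ g : E, (inner ℂ g (covariance μ b g)).re = 0 → g = 0) {n : ℕ} {lam s : ℝ}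
    (hlam0 : 0 < lam) (hlam : ∀ g : E, (inner ℂ g (covariance μ b g)).re ≤ lam * ‖g‖ ^ 2)
    (hs0 : 0 < s) (hT : ∫ x, ‖b x‖ ^ 2 ∂μ = lam * (1 + n * s ^ 2)) (hns : 1 ≤ n * s) :
    ∃ p, IsUpperStrategy μ b p ∧ ∀ A, p n A → ∀ g,
      (inner ℂ g (A g)).re ≤ n * lam * (1 + s) ^ 2 * ‖g‖ ^ 2 := by
  set W := covariance μ b with hW
  set T := ∫ x, ‖b x‖ ^ 2 ∂μ with hTdef
  have hT0 : 0 < T := by rw [hT]; positivity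
  set ψ := s / (1 + s) with hψ
  have hψ0 : 0 < ψ := by positivity
  -- The shift δ = 1 + s and the bound ψ = s/(1 + s) satisfy 1/δ + ψ = 1; the initial gap (T/ψ)·1
  -- has potential ψ.
  refine ⟨fun k A => ∃ S, IsPosInverse (((T / ψ : ℝ) : ℂ) • (1 : E →L[ℂ] E)
    + ((k * (1 + s) : ℝ) : ℂ) • W - A) S ∧ potential μ b S ≤ ψ,
    ⟨⟨((ψ / T : ℝ) : ℂ) • (1 : E →L[ℂ] E), ?_, ?_⟩, ?_⟩, ?_⟩
  · have h1 : IsPosInverse (1 : E →L[ℂ] E) 1 :=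
      ⟨ContinuousLinearMap.isPositive_one, one_mul _, one_mul _⟩
    have := h1.smul (c := T / ψ) (by positivity)
    simpa using this
  · have := potential_add_smul hb 0 1 (ψ / T)
    rw [zero_add, potential_one] at this
    rw [this]
    have h0 : potential μ b (0 : E →L[ℂ] E) = 0 := by simp [potential]
    rw [h0, zero_add, ← hTdef, div_mul_cancel₀ _ hT0.ne']
  · rintro k A ⟨S, hS, hSψ⟩
    obtain ⟨U, hUi, hU0, hU1, hU⟩ := upper_barrier_step hb hinj hS hSψ (δ := 1 + s) (by positivity)
      (by rw [hψ, ← add_div, div_self (by positivity)])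
    refine ⟨U, hUi, hU0, hU1, fun x t ht htU => ?_⟩
    obtain ⟨S', hS', hS'ψ⟩ := hU x t ht htU
    refine ⟨S', ?_, hS'ψ⟩
    convert hS' using 1
    push_cast
    module
  · rintro A ⟨S, hS, hSψ⟩ g
    have h1 := hS.re_inner_covariance_le hb g
    have h2 : (inner ℂ g ((((T / ψ : ℝ) : ℂ) • (1 : E →L[ℂ] E)
        + ((n * (1 + s) : ℝ) : ℂ) • W - A) g)).re
        = T / ψ * ‖g‖ ^ 2 + n * (1 + s) * (inner ℂ g (W g)).re - (inner ℂ g (A g)).re := by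
      have : (inner ℂ g g).re = ‖g‖ ^ 2 := inner_self_eq_norm_sq (𝕜 := ℂ) g
      rw [sub_apply, add_apply, smul_apply, smul_apply, inner_sub_right, inner_add_right,
        Complex.sub_re, Complex.add_re, re_inner_real_smul, re_inner_real_smul]
      change T / ψ * (inner ℂ g g).re + _ - _ = _
      rw [this]
    have h3 := h1.trans (mul_le_mul_of_nonneg_right hSψ (hS.pos.re_inner_nonneg_right g))
    change _ ≤ ψ * (inner ℂ g ((((T / ψ : ℝ) : ℂ) • (1 : E →L[ℂ] E)
        + ((n * (1 + s) : ℝ) : ℂ) • W - A) g)).re at h3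
    rw [h2] at h3
    have h5 := hlam g
    change (inner ℂ g (W g)).re ≤ _ at h3
    set w := (inner ℂ g (W g)).re
    set a := (inner ℂ g (A g)).re
    set N := ‖g‖ ^ 2
    have e2 : (1 + s) * ψ = s := by rw [hψ, mul_div_cancel₀ _ (by positivity)]
    have e1 : ψ * (T / ψ * N + n * (1 + s) * w - a) = T * N + n * s * w - ψ * a := by
      have : ψ * (T / ψ * N + n * (1 + s) * w - a)
        = T * N + n * ((1 + s) * ψ) * w - ψ * a := by field_simp
      rw [this, e2]
    rw [e1] at h3
    -- W ≤ ψR gives ψA ≤ T + (ns - 1)W; bounding W by λ here needs ns ≥ 1.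
    have h6 : (n * s - 1) * w ≤ (n * s - 1) * (lam * N) :=
      mul_le_mul_of_nonneg_left h5 (by linarith)
    have h7 : ψ * a ≤ ψ * (n * lam * (1 + s) ^ 2 * N) := by
      have e3 : ψ * (n * lam * (1 + s) ^ 2 * N) = n * lam * (1 + s) * ((1 + s) * ψ) * N := by ring
      rw [e3, e2]
      rw [hT] at h3
      nlinarith
    exact le_of_mul_le_mul_left h7 hψ0

/-- For ns ≤ 1 the crude bound A ≤ nT, without barriers, is enough: T = λ(1 + ns²) ≤ λ(1 + s)². -/
theorem exists_upperStrategy (hb : MemLp b 2 μ)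
    (hinj : ∀ g : E, (inner ℂ g (covariance μ b g)).re = 0 → g = 0) {n : ℕ} {lam s : ℝ}
    (hlam0 : Nontrivial E → 0 < lam)
    (hlam : ∀ g : E, (inner ℂ g (covariance μ b g)).re ≤ lam * ‖g‖ ^ 2)
    (hs0 : 0 ≤ s) (hT : Nontrivial E → ∫ x, ‖b x‖ ^ 2 ∂μ = lam * (1 + n * s ^ 2)) :
    ∃ p, IsUpperStrategy μ b p ∧ ∀ A, p n A → ∀ g,
      (inner ℂ g (A g)).re ≤ n * lam * (1 + s) ^ 2 * ‖g‖ ^ 2 := by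
  rcases subsingleton_or_nontrivial E with hE | hE
  · refine ⟨fun _ _ => True, ⟨trivial, fun k A _ => ⟨0, integrable_zero _ _ _, fun _ => le_rfl,
      by simp, fun _ _ _ _ => trivial⟩⟩, fun A _ g => ?_⟩
    rw [Subsingleton.elim g 0]; simp
  · have hl := hlam0 hE
    have hT := hT hE
    rcases le_total 1 (n * s) with hns | hns
    · have hs : 0 < s := hs0.lt_of_ne fun h => by rw [← h] at hns; norm_num at hns
      exact exists_upperStrategy_of_one_le hb hinj hl hlam hs hT hns
    · obtain ⟨p, hp, hpn⟩ := exists_upperStrategy_of_pos (μ := μ) hb n (by rw [hT]; positivity)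
      refine ⟨p, hp, fun A hA g => (hpn A hA g).trans ?_⟩
      rw [hT]
      have h1 : n * s ^ 2 ≤ s := by nlinarith
      have h2 : 1 + n * s ^ 2 ≤ (1 + s) ^ 2 := by nlinarith
      rw [← mul_assoc]
      gcongr

end Upper

end Strategies

/-! ### Kernel functions as a square-integrable map -/

section Kernel

variable {D G : Type*} [NormedAddCommGroup G] [InnerProductSpace ℂ G] [RKHS ℂ G D ℂ]

theorem inner_kerFun_one [CompleteSpace G] (x : D) (f : G) :
    inner ℂ (RKHS.kerFun G x 1) f = f x := by
  simp

variable [MeasurableSpace D] {μ : Measure D}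

theorem eLpNorm_two_sq {F : Type*} [NormedAddCommGroup F] (f : D → F) :
    eLpNorm f 2 μ ^ 2 = ∫⁻ x, ‖f x‖ₑ ^ 2 ∂μ := by
  have h := eLpNorm_nnreal_pow_eq_lintegral (f := f) (μ := μ) (p := 2) two_ne_zero
  simpa using h

theorem eLpNorm_sq_le_embeddingConst (g : G) :
    eLpNorm (⇑g : D → ℂ) 2 μ ^ 2 ≤ embeddingConst G μ * ‖g‖ₑ ^ 2 := by
  rcases eq_or_ne g 0 with rfl | hg
  · simp
  · rw [← ENNReal.div_le_iff (by simpa using hg) (by simp)]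
    exact le_iSup₂ (f := fun (f : G) (_ : f ≠ 0) => eLpNorm (⇑f : D → ℂ) 2 μ ^ 2 / ‖f‖ₑ ^ 2) g hg

variable [CompleteSpace G]

theorem kernelTrace_eq_lintegral :
    kernelTrace G μ = ∫⁻ x, ‖RKHS.kerFun G x 1‖ₑ ^ 2 ∂μ := by
  unfold kernelTrace
  refine lintegral_congr fun x => ?_
  rw [scalarKernel_self, Complex.ofReal_re, ENNReal.ofReal_pow (norm_nonneg _), ofReal_norm]

/-- Pointwise Cauchy–Schwarz, |f(x)|² ≤ K(x,x)‖f‖². It makes the radicand of s nonnegative. -/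
theorem embeddingConst_le_kernelTrace : embeddingConst G μ ≤ kernelTrace G μ := by
  refine iSup₂_le fun f hf => ?_
  rw [ENNReal.div_le_iff (by simpa using hf) (by simp), kernelTrace_eq_lintegral, eLpNorm_two_sq,
    ← lintegral_mul_const' _ _ (by simp)]
  refine lintegral_mono fun x => ?_
  rw [← mul_pow, ← inner_kerFun_one x f]
  refine pow_le_pow_left' ?_ 2
  rw [← ofReal_norm, ← ofReal_norm, ← ofReal_norm, ← ENNReal.ofReal_mul (norm_nonneg _)]
  exact ENNReal.ofReal_le_ofReal (norm_inner_le_norm _ _)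

/-- With a finite trace, the kernel functions depend measurably on the point: by injectivity of
the embedding into `L₂` an orthonormal basis is countable. -/
theorem FiniteTraceEmbedding.memLp_kerFun (hG : FiniteTraceEmbedding G μ) :
    MemLp (fun x => RKHS.kerFun G x 1) 2 μ := by
  obtain ⟨w, e, -⟩ := exists_hilbertBasis ℂ G
  have hsum : ∑' i, eLpNorm (⇑(e i) : D → ℂ) 2 μ ^ 2 ≤ kernelTrace G μ := by
    rw [ENNReal.tsum_eq_iSup_sum]
    refine iSup_le fun F => ?_
    simp_rw [eLpNorm_two_sq]
    rw [← lintegral_finsetSum' _ fun i _ =>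
      (hG.memLp (e i)).aestronglyMeasurable.enorm.pow_const 2, kernelTrace_eq_lintegral]
    refine lintegral_mono fun x => ?_
    have h := e.orthonormal.sum_inner_products_le (x := RKHS.kerFun G x 1) (s := F)
    have h' : ∑ i ∈ F, ‖(e i) x‖ ^ 2 ≤ ‖RKHS.kerFun G x 1‖ ^ 2 := by
      refine le_trans (le_of_eq (Finset.sum_congr rfl fun i _ => ?_)) h
      rw [← inner_kerFun_one x (e i), norm_inner_symm]
    have h2 := ENNReal.ofReal_le_ofReal h'
    rw [ENNReal.ofReal_sum_of_nonneg fun i _ => by positivity] at h2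
    simpa only [ENNReal.ofReal_pow (norm_nonneg _), ofReal_norm] using h2
  have hcount : Countable w := by
    have h := Summable.countable_support_ennreal (hsum.trans_lt hG.finite_trace).ne
    have huniv : Function.support (fun i => eLpNorm (⇑(e i) : D → ℂ) 2 μ ^ 2) = Set.univ := by
      refine Set.eq_univ_of_forall fun i => ?_
      exact pow_ne_zero 2 (hG.injective _ (e.orthonormal.ne_zero i))
    rw [huniv] at h
    exact Set.countable_univ_iff.1 h
  have hmeas : AEStronglyMeasurable (fun x => RKHS.kerFun G x 1) μ := by
    -- Countability of the basis makes this filter countably generated, as limits of measurable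
    -- functions require.
    refine aestronglyMeasurable_of_tendsto_ae (Filter.atTop : Filter (Finset w))
      (f := fun F x => ∑ i ∈ F, e.repr (RKHS.kerFun G x 1) i • e i) (fun F => ?_)
      (Filter.Eventually.of_forall fun x => e.hasSum_repr _)
    refine Finset.aestronglyMeasurable_fun_sum _ fun i _ => ?_
    refine AEStronglyMeasurable.smul_const ?_ _
    have : (fun x => e.repr (RKHS.kerFun G x 1) i) = fun x => star ((e i) x) := by
      funext x
      rw [e.repr_apply_apply, ← inner_conj_symm, inner_kerFun_one]
      rfl
    rw [this]
    exact (hG.memLp (e i)).aestronglyMeasurable.star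
  refine ⟨hmeas, ?_⟩
  have h := hG.finite_trace
  rw [kernelTrace_eq_lintegral, ← eLpNorm_two_sq] at h
  exact (ENNReal.pow_lt_top_iff.1 h).resolve_right two_ne_zero

namespace FiniteTraceEmbedding

variable (hG : FiniteTraceEmbedding G μ)
include hG

theorem integral_norm_kerFun_sq :
    ∫ x, ‖RKHS.kerFun G x 1‖ ^ 2 ∂μ = (kernelTrace G μ).toReal := by
  rw [integral_eq_lintegral_of_nonneg_ae (Filter.Eventually.of_forall fun x => by positivity)
    (hG.memLp_kerFun.integrable_norm_pow two_ne_zero).aestronglyMeasurable,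
    kernelTrace_eq_lintegral]
  simp only [ENNReal.ofReal_pow (norm_nonneg _), ofReal_norm]

theorem re_inner_covariance_eq (g : G) :
    (inner ℂ g (covariance μ (fun x => RKHS.kerFun G x 1) g)).re
      = (eLpNorm (⇑g : D → ℂ) 2 μ).toReal ^ 2 := by
  rw [re_inner_covariance_self hG.memLp_kerFun, ← ENNReal.toReal_pow, eLpNorm_two_sq]
  simp only [inner_kerFun_one]
  rw [integral_eq_lintegral_of_nonneg_ae (Filter.Eventually.of_forall fun x => by positivity)
    ((hG.memLp g).integrable_norm_pow two_ne_zero).aestronglyMeasurable]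
  simp only [ENNReal.ofReal_pow (norm_nonneg _), ofReal_norm]

theorem eq_zero_of_re_inner_covariance_eq_zero (g : G)
    (hg : (inner ℂ g (covariance μ (fun x => RKHS.kerFun G x 1) g)).re = 0) : g = 0 := by
  rw [hG.re_inner_covariance_eq, sq_eq_zero_iff] at hg
  by_contra hne
  exact ENNReal.toReal_ne_zero.2 ⟨hG.injective g hne, (hG.memLp g).eLpNorm_ne_top⟩ hg

theorem toReal_eLpNorm_sq_le (g : G) :
    (eLpNorm (⇑g : D → ℂ) 2 μ).toReal ^ 2 ≤ (embeddingConst G μ).toReal * ‖g‖ ^ 2 := by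
  have h := ENNReal.toReal_mono (ENNReal.mul_ne_top hG.continuous.ne (by simp))
    (eLpNorm_sq_le_embeddingConst g)
  simpa using h

theorem toReal_embeddingConst_pos [Nontrivial G] : 0 < (embeddingConst G μ).toReal := by
  obtain ⟨g, hg⟩ := exists_ne (0 : G)
  have h1 := hG.toReal_eLpNorm_sq_le g
  have h2 : 0 < (eLpNorm (⇑g : D → ℂ) 2 μ).toReal :=
    ENNReal.toReal_pos (hG.injective g hg) (hG.memLp g).eLpNorm_ne_top
  exact pos_of_mul_pos_left ((pow_pos h2 2).trans_le h1) (by positivity)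

theorem toReal_embeddingConst_le :
    (embeddingConst G μ).toReal ≤ (kernelTrace G μ).toReal :=
  ENNReal.toReal_mono hG.finite_trace.ne embeddingConst_le_kernelTrace

theorem submodule (W : Submodule ℂ G) [CompleteSpace W] : FiniteTraceEmbedding W μ where
  memLp f := hG.memLp (f : G)
  continuous := by
    refine lt_of_le_of_lt (iSup₂_le fun f hf => ?_) hG.continuous
    exact le_iSup₂ (f := fun (f : G) (_ : f ≠ 0) => eLpNorm (⇑f : D → ℂ) 2 μ ^ 2 / ‖f‖ₑ ^ 2)
      (f : G) (by simpa using hf)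
  injective f hf := hG.injective (f : G) (by simpa using hf)
  finite_trace := by
    refine lt_of_le_of_lt ?_ hG.finite_trace
    rw [kernelTrace_eq_lintegral, kernelTrace_eq_lintegral]
    refine lintegral_mono fun x => ?_
    -- Both kernel functions reproduce k(x), so ‖k‖² = ⟨K(·,x), k⟩.
    have h : ‖RKHS.kerFun W x 1‖ ≤ ‖RKHS.kerFun G x 1‖ := by
      set k := RKHS.kerFun W x 1
      have h1 : inner ℂ k k = inner ℂ (RKHS.kerFun G x 1) (k : G) := by
        rw [inner_kerFun_one, inner_kerFun_one]; rfl
      have h2 : ‖k‖ ^ 2 ≤ ‖RKHS.kerFun G x 1‖ * ‖k‖ := by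
        have h3 : ‖inner ℂ k k‖ = ‖k‖ ^ 2 := by
          rw [inner_self_eq_norm_sq_to_K]; simp
        rw [← h3, h1]
        exact norm_inner_le_norm _ _
      rcases (norm_nonneg k).eq_or_lt with h0 | h0
      · rw [← h0]; positivity
      · rw [sq] at h2; exact le_of_mul_le_mul_right h2 h0
    have h' : ‖RKHS.kerFun W x 1‖ₑ ≤ ‖RKHS.kerFun G x 1‖ₑ := by
      rw [← ofReal_norm, ← ofReal_norm]; exact ENNReal.ofReal_le_ofReal h
    gcongr

end FiniteTraceEmbedding

end Kernel

/-! ### Weighted least squares as orthogonal projection -/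

section LeastSquares

theorem norm_sub_sq_eq_of_mem {F : Type*} [NormedAddCommGroup F] [InnerProductSpace ℂ F]
    (K : Submodule ℂ F) [K.HasOrthogonalProjection] (y z : F) (hz : z ∈ K) :
    ‖y - z‖ ^ 2 = ‖y - K.starProjection y‖ ^ 2 + ‖K.starProjection y - z‖ ^ 2 := by
  have h1 : inner ℂ (y - K.starProjection y) (K.starProjection y - z) = 0 :=
    Submodule.inner_left_of_mem_orthogonal
      (K.sub_mem (K.starProjection_apply_mem y) hz) (K.sub_starProjection_mem_orthogonal y)
  have h2 := norm_add_sq_eq_norm_sq_add_norm_sq_of_inner_eq_zero _ _ h1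
  rw [sub_add_sub_cancel] at h2
  simpa only [sq] using h2

variable {D H : Type*} [NormedAddCommGroup H] [InnerProductSpace ℂ H] [RKHS ℂ H D ℂ] {n : ℕ}

/-- The data vector `(√wᵢ yᵢ)ᵢ` of a weighted least squares problem. -/
noncomputable def weightedData (w : Fin n → ℝ) : (Fin n → ℂ) →ₗ[ℂ] EuclideanSpace ℂ (Fin n) where
  toFun y := WithLp.toLp 2 fun i => (Real.sqrt (w i) : ℂ) * y i
  map_add' y z := by ext i; simp [mul_add]
  map_smul' a y := by ext i; simp; ring

theorem norm_weightedData_sq {w : Fin n → ℝ} (hw : ∀ i, 0 < w i) (y : Fin n → ℂ) :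
    ‖weightedData w y‖ ^ 2 = ∑ i, w i * ‖y i‖ ^ 2 := by
  rw [EuclideanSpace.norm_sq_eq]
  refine Finset.sum_congr rfl fun i _ => ?_
  simp [weightedData, mul_pow, Real.sq_sqrt (hw i).le]

/-- The weighted samples `(√wᵢ g(xᵢ))ᵢ` of a function `g`. -/
noncomputable def weightedSamples (x : Fin n → D) (w : Fin n → ℝ) :
    H →ₗ[ℂ] EuclideanSpace ℂ (Fin n) where
  toFun g := weightedData w fun i => g (x i)
  map_add' g h := by rw [← map_add]; congr 1; ext i; simp
  map_smul' a g := by rw [← map_smul]; congr 1; ext i; simp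

theorem norm_weightedSamples_sq (x : Fin n → D) {w : Fin n → ℝ} (hw : ∀ i, 0 < w i) (g : H) :
    ‖weightedSamples x w g‖ ^ 2 = ∑ i, w i * ‖g (x i)‖ ^ 2 :=
  norm_weightedData_sq hw _

/-- By Pythagoras, minimizers are the elements of V whose samples are the projection of the data
onto the sampled V. Only uniqueness needs sampling to be injective on V. -/
theorem isWeightedLeastSquares_iff (V : Submodule ℂ H) (x : Fin n → D) {w : Fin n → ℝ}
    (hw : ∀ i, 0 < w i) (y : Fin n → ℂ) (g : H) :
    IsWeightedLeastSquares V x w y g ↔ g ∈ V ∧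
      weightedSamples x w g
        = (V.map (weightedSamples x w)).starProjection (weightedData w y) := by
  set K := V.map (weightedSamples x w)
  have hK : ∀ h ∈ V, ∑ i, w i * ‖y i - h (x i)‖ ^ 2
      = ‖weightedData w y - K.starProjection (weightedData w y)‖ ^ 2
        + ‖K.starProjection (weightedData w y) - weightedSamples x w h‖ ^ 2 := fun h hh => by
    rw [← norm_sub_sq_eq_of_mem K _ _ (Submodule.mem_map_of_mem hh)]
    have : weightedData w y - weightedSamples x w h = weightedData w fun i => y i - h (x i) :=
      (map_sub (weightedData w) y fun i => h (x i)).symm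
    rw [this, norm_weightedData_sq hw]
  refine and_congr_right fun hg => ⟨fun hmin => ?_, fun heq h hh => ?_⟩
  · obtain ⟨h, hh, hhp⟩ := K.starProjection_apply_mem (weightedData w y)
    have h1 := hmin h hh
    rw [hK g hg, hK h hh, hhp, sub_self, norm_zero] at h1
    have h2 : ‖K.starProjection (weightedData w y) - weightedSamples x w g‖ ^ 2 = 0 :=
      le_antisymm (by linarith) (sq_nonneg _)
    rw [sq_eq_zero_iff, norm_eq_zero, sub_eq_zero] at h2
    exact h2.symm
  · rw [hK g hg, hK h hh, heq, sub_self, norm_zero]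
    have := sq_nonneg ‖K.starProjection (weightedData w y) - weightedSamples x w h‖
    linarith

theorem existsUnique_isWeightedLeastSquares (V : Submodule ℂ H) (x : Fin n → D) {w : Fin n → ℝ}
    (hw : ∀ i, 0 < w i)
    (hV : ∀ g ∈ V, ∑ i, w i * ‖g (x i)‖ ^ 2 = 0 → g = 0) (y : Fin n → ℂ) :
    ∃! g : H, IsWeightedLeastSquares V x w y g := by
  simp_rw [isWeightedLeastSquares_iff V x hw]
  obtain ⟨g, hg, hgp⟩ :=
    (V.map (weightedSamples x w)).starProjection_apply_mem (weightedData w y)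
  refine ⟨g, ⟨hg, hgp⟩, fun h ⟨hh, hhp⟩ => ?_⟩
  rw [← sub_eq_zero]
  refine hV _ (V.sub_mem hh hg) ?_
  rw [← norm_weightedSamples_sq x hw, map_sub, hhp, hgp, sub_self]
  simp

theorem IsWeightedLeastSquares.sum_norm_sub_sq_le {V : Submodule ℂ H} {x : Fin n → D}
    {w : Fin n → ℝ} (hw : ∀ i, 0 < w i) {f g a : H}
    (hg : IsWeightedLeastSquares V x w (fun i => f (x i)) g) (ha : a ∈ V) :
    ∑ i, w i * ‖(a - g) (x i)‖ ^ 2 ≤ ∑ i, w i * ‖(f - a) (x i)‖ ^ 2 := by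
  obtain ⟨-, hgp⟩ := (isWeightedLeastSquares_iff V x hw _ g).1 hg
  rw [← norm_weightedSamples_sq x hw, ← norm_weightedSamples_sq x hw]
  set K := V.map (weightedSamples x w)
  have h1 : weightedSamples x w (a - g) = - K.starProjection (weightedSamples x w (f - a)) := by
    have h2 : K.starProjection (weightedSamples x w a) = weightedSamples x w a :=
      Submodule.starProjection_eq_self_iff.2 (Submodule.mem_map_of_mem ha)
    rw [map_sub, map_sub, map_sub, h2, hgp, neg_sub]
    rfl
  rw [h1, norm_neg]
  gcongr
  exact K.norm_starProjection_apply_le _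

end LeastSquares

/-! ### Frame bounds and the recovery estimate -/

section Recovery

variable {D H : Type*} [MeasurableSpace D] {μ : Measure D} [NormedAddCommGroup H]
  [InnerProductSpace ℂ H] [CompleteSpace H] [RKHS ℂ H D ℂ]

/-- Points and weights with a lower frame bound on `V` in terms of the `L₂` norm and an upper frame
bound on the orthogonal complement in terms of the norm of `H`. -/
theorem exists_points_weights (hH : FiniteTraceEmbedding H μ) (V : Submodule ℂ H)
    [FiniteDimensional ℂ V] {n : ℕ} (hn : 0 < n) {r s : ℝ} (hr0 : 0 ≤ r) (hr1 : r < 1)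
    (hr : (Module.finrank ℂ V : ℝ) - 1 = n * r ^ 2)
    (hs : s = Real.sqrt (((kernelTrace Vᗮ μ).toReal - (embeddingConst Vᗮ μ).toReal)
      / (n * (embeddingConst Vᗮ μ).toReal))) :
    ∃ (x : Fin n → D) (w : Fin n → ℝ), (∀ i, 0 < w i) ∧
      (∀ g ∈ V, n * (1 - r) ^ 2 * (eLpNorm (⇑g : D → ℂ) 2 μ).toReal ^ 2
        ≤ ∑ i, w i * ‖g (x i)‖ ^ 2) ∧
      ∀ h ∈ Vᗮ, ∑ i, w i * ‖h (x i)‖ ^ 2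
        ≤ n * (embeddingConst Vᗮ μ).toReal * (1 + s) ^ 2 * ‖h‖ ^ 2 := by
  have : CompleteSpace V := FiniteDimensional.complete ℂ V
  have hV := hH.submodule V
  have hVo := hH.submodule Vᗮ
  obtain ⟨p, hp, hpn⟩ := exists_lowerStrategy hV.memLp_kerFun
    hV.eq_zero_of_re_inner_covariance_eq_zero hr0 hr1 hr
  obtain ⟨q, hq, hqn⟩ := exists_upperStrategy (n := n) (s := s)
    (lam := (embeddingConst Vᗮ μ).toReal) hVo.memLp_kerFun
    hVo.eq_zero_of_re_inner_covariance_eq_zero (fun _ => hVo.toReal_embeddingConst_pos)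
    (fun g => (hVo.re_inner_covariance_eq g).trans_le (hVo.toReal_eLpNorm_sq_le g))
    (hs ▸ Real.sqrt_nonneg _) (fun hnt => by
      have hpos := hVo.toReal_embeddingConst_pos
      have hle := hVo.toReal_embeddingConst_le
      have hn' : (0 : ℝ) < n := by exact_mod_cast hn
      rw [hVo.integral_norm_kerFun_sq, hs,
        Real.sq_sqrt (div_nonneg (sub_nonneg.2 hle) (by positivity))]
      field_simp
      ring)
  obtain ⟨x, w, hw, hpx, hqx⟩ := exists_points_of_strategies hp hq n
  refine ⟨x, w, hw, fun g hg => ?_, fun h hh => ?_⟩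
  · have h1 := hpn _ hpx ⟨g, hg⟩
    rw [hV.re_inner_covariance_eq, re_inner_sum_smul_rankOne] at h1
    simp only [inner_kerFun_one] at h1
    exact h1
  · have h1 := hqn _ hqx ⟨h, hh⟩
    rw [re_inner_sum_smul_rankOne] at h1
    simp only [inner_kerFun_one] at h1
    exact h1

end Recovery

end RKHSRecovery

theorem corollary3p1 {D H : Type*} [MeasurableSpace D] (μ : MeasureTheory.Measure D)
    [NormedAddCommGroup H] [InnerProductSpace ℂ H] [CompleteSpace H] [RKHS ℂ H D ℂ]
    (hH : RKHSRecovery.FiniteTraceEmbedding H μ)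
    (V : Submodule ℂ H) [FiniteDimensional ℂ V] (m n : ℕ) (hm : 1 ≤ m)
    (hV : Module.finrank ℂ V = m) (hmn : m ≤ n)
    (lam T r s : ℝ)
    (hlam : lam = (RKHSRecovery.embeddingConst Vᗮ μ).toReal)
    (hT : T = (RKHSRecovery.kernelTrace Vᗮ μ).toReal)
    (hr : r = Real.sqrt (((m : ℝ) - 1) / n))
    (hs : s = Real.sqrt ((T - lam) / (n * lam))) :
    ∃ (x : Fin n → D) (w : Fin n → ℝ), (∀ i, 0 < w i) ∧
      (∀ y : Fin n → ℂ, ∃! g : H, RKHSRecovery.IsWeightedLeastSquares V x w y g) ∧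
      ∀ f g : H, RKHSRecovery.IsWeightedLeastSquares V x w (fun i => f (x i)) g →
        MeasureTheory.eLpNorm (⇑(f - g) : D → ℂ) 2 μ ≤
          ENNReal.ofReal ((1 + (1 + s) / (1 - r)) * Real.sqrt lam * ‖f - V.starProjection f‖) := by
  have hn : 0 < n := by omega
  have hn' : (0 : ℝ) < n := by exact_mod_cast hn
  have hm' : (1 : ℝ) ≤ m := by exact_mod_cast hm
  have hmn' : (m : ℝ) ≤ n := by exact_mod_cast hmn
  have hr0 : 0 ≤ r := hr ▸ Real.sqrt_nonneg _
  have hr2 : r ^ 2 = ((m : ℝ) - 1) / n := by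
    rw [hr, Real.sq_sqrt (div_nonneg (by linarith) hn'.le)]
  have hr1 : r < 1 := by
    have : r ^ 2 < 1 := by rw [hr2, div_lt_one hn']; linarith
    nlinarith
  have h1r : 0 < 1 - r := by linarith
  -- If V is all of H, then T = lam = 0 and division by zero yields s = 0, the stated convention.
  have hs0 : 0 ≤ s := hs ▸ Real.sqrt_nonneg _
  have hlam0 : 0 ≤ lam := hlam ▸ ENNReal.toReal_nonneg
  obtain ⟨x, w, hw, hlow, hup⟩ := RKHSRecovery.exists_points_weights hH V hn hr0 hr1
    (by rw [hr2, hV]; field_simp) (hs.trans (by rw [hT, hlam]))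
  rw [← hlam] at hup
  refine ⟨x, w, hw, RKHSRecovery.existsUnique_isWeightedLeastSquares V x hw
    fun g hg hg0 => ?_, fun f g hfg => ?_⟩
  · have h1 := hlow g hg
    rw [hg0] at h1
    have h2 : (MeasureTheory.eLpNorm (⇑g : D → ℂ) 2 μ).toReal ^ 2 ≤ 0 := by
      by_contra hpos
      push Not at hpos
      have : 0 < n * (1 - r) ^ 2 * (MeasureTheory.eLpNorm (⇑g : D → ℂ) 2 μ).toReal ^ 2 := by
        positivity
      linarith
    by_contra hne
    have := ENNReal.toReal_pos (hH.injective g hne) (hH.memLp g).eLpNorm_ne_top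
    have := pow_pos this 2
    linarith
  · set a := V.starProjection f with ha
    have haV : a ∈ V := V.starProjection_apply_mem f
    have hao : f - a ∈ Vᗮ := V.sub_starProjection_mem_orthogonal f
    set α := (MeasureTheory.eLpNorm (⇑(a - g) : D → ℂ) 2 μ).toReal with hα
    set β := (MeasureTheory.eLpNorm (⇑(f - a) : D → ℂ) 2 μ).toReal with hβ
    have hβle : β ≤ Real.sqrt lam * ‖f - a‖ := by
      have h1 := (hH.submodule Vᗮ).toReal_eLpNorm_sq_le ⟨f - a, hao⟩
      rw [← hlam] at h1
      change β ^ 2 ≤ lam * ‖f - a‖ ^ 2 at h1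
      refine le_of_sq_le_sq ?_ (by positivity)
      rwa [mul_pow, Real.sq_sqrt hlam0]
    -- n(1-r)²α² ≤ ∑ wᵢ|(a-g)(xᵢ)|² ≤ ∑ wᵢ|(f-a)(xᵢ)|² ≤ n lam (1+s)²‖f-a‖².
    have hαle : α ≤ (1 + s) / (1 - r) * Real.sqrt lam * ‖f - a‖ := by
      have h1 := (hlow (a - g) (V.sub_mem haV hfg.1)).trans
        ((hfg.sum_norm_sub_sq_le hw haV).trans (hup _ hao))
      have h2 : n * ((1 - r) * α) ^ 2 ≤ n * ((1 + s) * Real.sqrt lam * ‖f - a‖) ^ 2 := by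
        rw [mul_pow, mul_pow, mul_pow, Real.sq_sqrt hlam0]
        linarith
      have h3 := le_of_sq_le_sq (le_of_mul_le_mul_left h2 hn') (by positivity)
      rw [div_mul_eq_mul_div, div_mul_eq_mul_div, le_div_iff₀ h1r]
      linarith
    have hsum : (⇑(f - g) : D → ℂ) = ⇑(f - a) + ⇑(a - g) := by
      rw [← RKHS.coe_add, sub_add_sub_cancel]
    have hβt := (hH.memLp (f - a)).eLpNorm_ne_top
    have hαt := (hH.memLp (a - g)).eLpNorm_ne_top
    rw [hsum]
    refine (MeasureTheory.eLpNorm_add_le (hH.memLp (f - a)).aestronglyMeasurable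
      (hH.memLp (a - g)).aestronglyMeasurable one_le_two).trans ?_
    rw [← ENNReal.ofReal_toReal hβt, ← ENNReal.ofReal_toReal hαt,
      ← ENNReal.ofReal_add ENNReal.toReal_nonneg ENNReal.toReal_nonneg]
    refine ENNReal.ofReal_le_ofReal ?_
    change β + α ≤ _
    calc β + α ≤ Real.sqrt lam * ‖f - a‖ + (1 + s) / (1 - r) * Real.sqrt lam * ‖f - a‖ :=
          add_le_add hβle hαle
      _ = _ := by ring
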